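/- Let $\beta>0$ and $h\in C^2(\mathbb R^d)$. Let $(X_t)_{t\ge 0}$ be a process in $\mathbb R^d$, on some probability space, such that for every $t\ge0$ the law of $X_t$ has a density $p(\cdot,t)$, with $p(\cdot,0)=p_0^*$ a given prior density. Suppose that $X$ follows the particle filter $$\frac{dX_t}{dt}=-\beta\,\nabla\phi(X_t,t),\qquad X_0\sim p_0^*,$$ (that is, almost surely $X_t=X_0-\beta\int_0^t\nabla\phi(X_s,s)\,ds$ for all $t\ge0$, with $\mathbb E\int_0^T|\nabla\phi(X_s,s)|\,ds<\infty$ for every $T$), where for each $t\ge 0$, with $\rho=p(\cdot,t)$, one has $h\in L^2(\mathbb R^d;\rho)$ and $\phi=\phi(\cdot,t)\in H^1(\mathbb R^d;\rho)$ is a weak solution of the weighted Poisson equation $$-\nabla\cdot(\rho\nabla\phi)=(h-\hat h)\rho,\qquad \int\phi\,\rho\,dx=0,\qquad \hat h=\int h\rho\,dx,$$ i.e. $\int\nabla\phi\cdot\nabla\psi\,\rho\,dx=\int(h-\hat h)\psi\,\rho\,dx$ for all $\psi\in H^1(\mathbb R^d;\rho)$. Let $\Theta\subseteq\mathbb R^M$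 be open (for instance $\Theta=\mathbb R^M$) and let $\varrho(\cdot;\vartheta)$, $\vartheta\in\Theta$, be everywhere positive probability densities on $\mathbb R^d$, differentiable in $\vartheta$, such that for every $\vartheta\in\Theta$ the function $h\varrho(\cdot;\vartheta)$ is integrable, the entries of $\frac{\partial}{\partial\vartheta}\log\varrho(\cdot;\vartheta)$ lie in $L^2(\mathbb R^d;\varrho(\cdot;\vartheta))$, and, for $\vartheta'$ in a neighbourhood of $\vartheta$, the functions $(1+|h|)\,\bigl|\frac{\partial}{\partial\vartheta}\varrho(\cdot;\vartheta')\bigr|$ are bounded almost everywhere by one integrable function. Assume that the Fisher information matrix $$G_{(\vartheta)}=\int\frac{\partial\log\varrho}{\partial\vartheta}(x;\vartheta)\left[\frac{\partial\log\varrho}{\partial\vartheta}(x;\vartheta)\right]^{T}\varrho(x;\vartheta)\,dx$$ is invertible for all $\vartheta\in\Theta$, and put $e(\vartheta)=\int h(x)\varrho(x;\vartheta)\,dx$. Suppose that $p(x,t)=\varrho(x;\theta_t)$ for all $t\ge0$ and almost every $x$, for a continuous curve $t\mapsto\theta_t\in\Theta$, $t\ge 0$. Then $e$ is differentiable on $\Theta$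 with $\nabla e(\vartheta)=\int h(x)\,\frac{\partial\log\varrho}{\partial\vartheta}(x;\vartheta)\,\varrho(x;\vartheta)\,dx$, the curve $\theta$ is differentiable (one-sidedly at $t=0$), and for all $t\ge0$ $$\frac{d\theta_t}{dt}=-\beta\,G_{(\theta_t)}^{-1}\nabla e(\theta_t).$$ -/

import Mathlib

open MeasureTheory Set Filter Topology
open scoped ContDiff Matrix

noncomputable section

namespace ParticleFlow

/-- Euclidean space of dimension `n`, with its Euclidean norm and Lebesgue measure. -/
abbrev E (n : ℕ) := EuclideanSpace ℝ (Fin n)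

/-- The measure `ρ(x) dx`. -/
def densityMeasure {d : ℕ} (ρ : E d → ℝ) : Measure (E d) :=
  volume.withDensity (fun x => ENNReal.ofReal (ρ x))

/-- `g` is the weak (distributional) gradient of `φ` on `ℝ^d`. -/
structure HasWeakGradient {d : ℕ} (φ : E d → ℝ) (g : E d → E d) : Prop where
  locallyIntegrable : LocallyIntegrable φ volume
  locallyIntegrable_grad : LocallyIntegrable g volume
  integral_eq : ∀ η : E d → ℝ, ContDiff ℝ ∞ η → HasCompactSupport η →
    ∫ x, φ x • gradient η x = -∫ x, η x • g x

/-- `φ` belongs to the weighted Sobolev space `H¹(ℝ^d; ρ)`, with weak gradient `g`. -/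
structure MemH1 {d : ℕ} (ρ : E d → ℝ) (φ : E d → ℝ) (g : E d → E d) : Prop where
  memLp : MemLp φ 2 (densityMeasure ρ)
  memLp_grad : MemLp g 2 (densityMeasure ρ)
  hasWeakGradient : HasWeakGradient φ g

/-- `φ`, with weak gradient `g`, is a weak solution in `H¹₀(ℝ^d; ρ)` of the weighted Poisson
equation `-∇·(ρ ∇φ) = (h - ĥ) ρ`, `∫ φ ρ = 0`, where `ĥ = ∫ h ρ` and `h ∈ L²(ℝ^d; ρ)`. -/
structure IsWeakPoissonSolution {d : ℕ} (h ρ : E d → ℝ) (φ : E d → ℝ) (g : E d → E d) :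
    Prop where
  memLp_data : MemLp h 2 (densityMeasure ρ)
  memH1 : MemH1 ρ φ g
  mean_zero : ∫ x, φ x * ρ x = 0
  weak_eq : ∀ (ψ : E d → ℝ) (gψ : E d → E d), MemH1 ρ ψ gψ →
    ∫ x, inner ℝ (g x) (gψ x) * ρ x = ∫ x, (h x - ∫ y, h y * ρ y) * ψ x * ρ x

/-- The particle filter: `X t` (`t ≥ 0`) is the state of a particle on the probability space
`(Ω, P)`, `p t` is the density of `X t`, `p₀` is the prior density, and the particle follows
`dX/dt = u(X, t)` with the control `u(·, t) = -β ∇φ(·, t)`, where `φ(·, t)` solves the Poisson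
equation weighted by `p t`. Here `gradφ t` is the weak gradient of `φ t`. -/
structure IsParticleFilter {d : ℕ} {Ω : Type*} [MeasurableSpace Ω] (P : Measure Ω)
    (β : ℝ) (h p₀ : E d → ℝ) (X : ℝ → Ω → E d) (p : ℝ → E d → ℝ)
    (φ : ℝ → E d → ℝ) (gradφ : ℝ → E d → E d) : Prop where
  measurable : ∀ t, 0 ≤ t → Measurable (X t)
  density_measurable : ∀ t, 0 ≤ t → Measurable (p t)
  density_nonneg : ∀ t, 0 ≤ t → ∀ x, 0 ≤ p t x
  law : ∀ t, 0 ≤ t → P.map (X t) = densityMeasure (p t)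
  law_zero : P.map (X 0) = densityMeasure p₀
  poisson : ∀ t, 0 ≤ t → IsWeakPoissonSolution h (p t) (φ t) (gradφ t)
  -- the velocity along the particle paths is integrable on bounded time intervals
  integrable_velocity : ∀ T, 0 ≤ T →
    Integrable (fun z : ℝ × Ω => gradφ z.1 (X z.1 z.2)) ((volume.restrict (Icc 0 T)).prod P)
  ode : ∀ᵐ w ∂P, ∀ t, 0 ≤ t → X t w = X 0 w + ∫ s in (0 : ℝ)..t, -β • gradφ s (X s w)

/-- The vector `∂/∂ϑ log ϱ(x; ϑ)`; its `k`-th entry is the partial derivative in `ϑ_k`. -/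
def score {d M : ℕ} (ϱ : E d → E M → ℝ) (x : E d) (ϑ : E M) : E M :=
  gradient (fun ϑ' => Real.log (ϱ x ϑ')) ϑ

/-- The Fisher information matrix of the family `ϱ` at `ϑ`. -/
def fisherInfo {d M : ℕ} (ϱ : E d → E M → ℝ) (ϑ : E M) : Matrix (Fin M) (Fin M) ℝ :=
  Matrix.of fun k l => ∫ x, score ϱ x ϑ k * score ϱ x ϑ l * ϱ x ϑ

/-- `e(ϑ) = ∫ h(x) ϱ(x; ϑ) dx`. -/
def expectedCost {d M : ℕ} (h : E d → ℝ) (ϱ : E d → E M → ℝ) (ϑ : E M) : ℝ :=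
  ∫ x, h x * ϱ x ϑ

/-- `∫ h(x) (∂/∂ϑ log ϱ(x; ϑ)) ϱ(x; ϑ) dx`, entry by entry. -/
def costGradient {d M : ℕ} (h : E d → ℝ) (ϱ : E d → E M → ℝ) (ϑ : E M) : E M :=
  WithLp.toLp 2 fun k => ∫ x, h x * score ϱ x ϑ k * ϱ x ϑ

/-- `ϱ(·; ϑ)`, `ϑ ∈ Θ`, is a family of everywhere positive probability densities on `ℝ^d`,
differentiable in the parameter, with finite Fisher information and finite mean of `h`, and
regular: the derivative in the parameter, weighted by `1 + |h|`, is locally dominated. -/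
structure IsRegularFamily {d M : ℕ} (h : E d → ℝ) (Θ : Set (E M)) (ϱ : E d → E M → ℝ) :
    Prop where
  measurable : ∀ ϑ ∈ Θ, Measurable fun x => ϱ x ϑ
  pos : ∀ ϑ ∈ Θ, ∀ x, 0 < ϱ x ϑ
  integral_eq_one : ∀ ϑ ∈ Θ, ∫ x, ϱ x ϑ = 1
  differentiableAt : ∀ ϑ ∈ Θ, ∀ x, DifferentiableAt ℝ (ϱ x) ϑ
  score_sq_integrable : ∀ ϑ ∈ Θ, ∀ k, Integrable fun x => score ϱ x ϑ k ^ 2 * ϱ x ϑ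
  cost_integrable : ∀ ϑ ∈ Θ, Integrable fun x => h x * ϱ x ϑ
  dominated : ∀ ϑ ∈ Θ, ∃ U ∈ 𝓝 ϑ, ∃ b : E d → ℝ, Integrable b ∧
    ∀ᵐ x, ∀ ϑ' ∈ U, (1 + |h x|) * ‖gradient (ϱ x) ϑ'‖ ≤ b x

end ParticleFlow

end

/-! Differentiating a test function `η` along the particle paths and taking expectations gives,
through the weak Poisson equation tested with `η` itself, d/dt ∫ η p = -β ∫ (h - ĥ) η p
(`integral_mul_density_sub`). Since p = ϱ(·; θ), the moment m_η(ϑ) = ∫ η ϱ(·; ϑ) has a continuous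
derivative along θ.

The curve θ is only assumed continuous, so its differentiability must be extracted from these
moments. A vector orthogonal to every gradient ∇m_η(θ_t) is orthogonal to the score almost
everywhere and hence lies in the kernel of G. So the gradients span, and combinations of moments
form a map whose derivative at θ_t is the identity; θ inherits differentiability from it.

The chain rule now reads ⟨∇m_η, θ'⟩ = -β ∫ (h - ĥ) η ϱ for all `η`, that is, ⟨score, θ'⟩ = -β (h -
ĥ) almost everywhere. Integrating this against score · ϱ yields G θ' = -β ∇e, because the score has
mean zero. -/

/-! ### Absolutely continuous curves, joint measurability, recovering a curve from functions along
it. -/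

theorem AbsolutelyContinuousOnInterval.of_dist_le {X Y : Type*} [PseudoMetricSpace X]
    [PseudoMetricSpace Y] {f : ℝ → X} {g : ℝ → Y} {a b : ℝ}
    (hg : AbsolutelyContinuousOnInterval g a b)
    (hfg : ∀ x ∈ uIcc a b, ∀ y ∈ uIcc a b, dist (f x) (f y) ≤ dist (g x) (g y)) :
    AbsolutelyContinuousOnInterval f a b := by
  rw [absolutelyContinuousOnInterval_iff] at hg ⊢
  intro ε hε
  obtain ⟨δ, hδ, H⟩ := hg ε hε
  refine ⟨δ, hδ, fun E hE hlt => lt_of_le_of_lt (Finset.sum_le_sum fun i hi => ?_) (H E hE hlt)⟩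
  exact hfg _ (hE.1 i hi).1 _ (hE.1 i hi).2

/-- The chain rule, in integral form, along an absolutely continuous curve. -/
theorem Differentiable.comp_primitive_sub_eq_integral {V : Type*} [NormedAddCommGroup V]
    [NormedSpace ℝ V] [CompleteSpace V] {η : V → ℝ} (hη : Differentiable ℝ η)
    {K : NNReal} (hK : LipschitzWith K η) {x v : ℝ → V} {T : ℝ} (hT : 0 ≤ T)
    (hv : IntervalIntegrable v volume 0 T)
    (hx : ∀ t ∈ Icc 0 T, x t = x 0 + ∫ s in (0 : ℝ)..t, v s) :
    η (x T) - η (x 0) = ∫ s in (0 : ℝ)..T, fderiv ℝ η (x s) (v s) := by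
  have hu : uIcc 0 T = Icc 0 T := uIcc_of_le hT
  let y : ℝ → V := fun t => x 0 + ∫ s in (0 : ℝ)..t, v s
  have hxy : ∀ t ∈ Icc 0 T, x t = y t := hx
  have hint : ∀ r ∈ uIcc 0 T, ∀ s ∈ uIcc 0 T, IntervalIntegrable v volume r s :=
    fun r hr s hs => hv.mono_set (uIcc_subset_uIcc hr hs)
  have hAC : AbsolutelyContinuousOnInterval (fun t => η (y t)) 0 T := by
    -- The increments of `η ∘ y` are dominated by those of `K` times the primitive of `‖v‖`.
    refine AbsolutelyContinuousOnInterval.of_dist_le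
      ((hv.norm.absolutelyContinuousOnInterval_intervalIntegral
        (left_mem_uIcc (a := (0 : ℝ)) (b := T))).const_mul (K : ℝ)) fun r hr s hs => ?_
    have h0 : (0 : ℝ) ∈ uIcc 0 T := left_mem_uIcc
    refine (hK.dist_le_mul _ _).trans ?_
    rw [Real.dist_eq, ← mul_sub, abs_mul, NNReal.abs_eq]
    refine mul_le_mul_of_nonneg_left ?_ K.2
    rw [intervalIntegral.integral_interval_sub_left (hint _ h0 _ hr).norm (hint _ h0 _ hs).norm,
      dist_eq_norm]
    simp only [y, add_sub_add_left_eq_sub]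
    rw [intervalIntegral.integral_interval_sub_left (hint _ h0 _ hr) (hint _ h0 _ hs)]
    exact intervalIntegral.norm_integral_le_abs_integral_norm
  rw [hxy T ⟨hT, le_rfl⟩, hxy 0 ⟨le_rfl, hT⟩, ← hAC.integral_deriv_eq_sub]
  refine intervalIntegral.integral_congr_ae ?_
  filter_upwards [hv.ae_hasDerivAt_integral] with s hs hsT
  have hsm : s ∈ uIcc 0 T := uIoc_subset_uIcc hsT
  rw [hxy s (hu ▸ hsm)]
  have h1 : HasDerivAt y (v s) s := (hs hsm 0 left_mem_uIcc).const_add _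
  exact ((hη (y s)).hasFDerivAt.comp_hasDerivAt s h1).deriv

/-- Continuity in time and measurability in `w` give joint measurability, as Fubini will require.
The exceptional paths are replaced by zero and time is clamped at 0, which makes every path
continuous on the whole line. -/
theorem aestronglyMeasurable_of_ae_continuousOn_Ici {Ω V : Type*} [MeasurableSpace Ω]
    {P : Measure Ω} [SFinite P] [TopologicalSpace V] [TopologicalSpace.PseudoMetrizableSpace V]
    [SecondCountableTopology V]
    [Zero V] [MeasurableSpace V] [BorelSpace V] {X : ℝ → Ω → V}
    (hm : ∀ t, 0 ≤ t → Measurable (X t))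
    (hc : ∀ᵐ w ∂P, ContinuousOn (fun t => X t w) (Ici 0)) (T : ℝ) :
    AEStronglyMeasurable (fun z : ℝ × Ω => X z.1 z.2) ((volume.restrict (Icc 0 T)).prod P) := by
  -- The set of continuous paths need not be measurable; `N` is a measurable subset of full measure.
  set N : Set Ω := (toMeasurable P {w | ContinuousOn (fun t => X t w) (Ici 0)}ᶜ)ᶜ with hN
  have hNm : MeasurableSet N := (measurableSet_toMeasurable _ _).compl
  have hNc : ∀ w ∈ N, ContinuousOn (fun t => X t w) (Ici 0) := by
    intro w hw
    by_contra hcon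
    exact hw (subset_toMeasurable _ _ hcon)
  have hNae : ∀ᵐ w ∂P, w ∈ N := by
    rw [ae_iff]
    change P Nᶜ = 0
    rw [hN, compl_compl, measure_toMeasurable]
    exact hc
  let Y : ℝ → Ω → V := fun t => N.indicator (X (max t 0))
  have hY : Measurable (Function.uncurry Y) := by
    refine measurable_uncurry_of_continuous_of_measurable (fun w => ?_)
      (fun t => (hm _ (le_max_right _ _)).indicator hNm)
    by_cases hw : w ∈ N
    · simp only [Y, indicator_of_mem hw]
      exact (hNc w hw).comp_continuous (by fun_prop) fun t => mem_Ici.2 (le_max_right _ _)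
    · simp only [Y, indicator_of_notMem hw]
      exact continuous_const
  refine ⟨_, hY.stronglyMeasurable, ?_⟩
  have h1 : ∀ᵐ z ∂((volume.restrict (Icc 0 T)).prod P), z.1 ∈ Icc 0 T :=
    Measure.quasiMeasurePreserving_fst.ae (ae_restrict_mem measurableSet_Icc)
  have h2 : ∀ᵐ z ∂((volume.restrict (Icc 0 T)).prod P), z.2 ∈ N :=
    Measure.quasiMeasurePreserving_snd.ae hNae
  filter_upwards [h1, h2] with z hz1 hz2
  simp [Function.uncurry, Y, hz2, max_eq_left hz1.1]

/-- If the functions which are differentiable along `θ` at `t` have enough gradients at `θ t`, then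
`θ` is differentiable at `t`. -/
theorem DifferentiableWithinAt.of_span_gradient_eq_top {M : ℕ}
    {θ : ℝ → EuclideanSpace ℝ (Fin M)} {s : Set ℝ} {t : ℝ} (hθ : ContinuousWithinAt θ s t)
    {S : Set (EuclideanSpace ℝ (Fin M))} (hS : Submodule.span ℝ S = ⊤)
    (hL : ∀ a ∈ S, ∃ L : EuclideanSpace ℝ (Fin M) → ℝ, HasGradientAt L a (θ t) ∧
      DifferentiableWithinAt ℝ (fun r => L (θ r)) s t) :
    DifferentiableWithinAt ℝ θ s t := by
  have key : ∀ a, ∃ L : EuclideanSpace ℝ (Fin M) → ℝ, HasGradientAt L a (θ t) ∧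
      DifferentiableWithinAt ℝ (fun r => L (θ r)) s t := by
    intro a
    have ha : a ∈ Submodule.span ℝ S := hS ▸ Submodule.mem_top
    induction ha using Submodule.span_induction with
    | mem x hx => exact hL x hx
    | zero => exact ⟨fun _ => 0, hasGradientAt_const _ _, differentiableWithinAt_const _⟩
    | add x y _ _ hx hy =>
      obtain ⟨L₁, h₁, d₁⟩ := hx
      obtain ⟨L₂, h₂, d₂⟩ := hy
      refine ⟨fun z => L₁ z + L₂ z, ?_, d₁.add d₂⟩
      rw [hasGradientAt_iff_hasFDerivAt, map_add]
      exact h₁.hasFDerivAt.add h₂.hasFDerivAt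
    | smul c x _ hx =>
      obtain ⟨L₁, h₁, d₁⟩ := hx
      refine ⟨fun z => c * L₁ z, ?_, d₁.const_mul c⟩
      rw [hasGradientAt_iff_hasFDerivAt]
      simpa using h₁.hasFDerivAt.const_mul c
  choose L hLg hLd using fun k : Fin M => key (EuclideanSpace.single k 1)
  let Λ : EuclideanSpace ℝ (Fin M) → EuclideanSpace ℝ (Fin M) :=
    fun z => WithLp.toLp 2 fun k => L k z
  have hΛ : HasFDerivAt Λ (ContinuousLinearMap.id ℝ _) (θ t) := by
    rw [← hasFDerivWithinAt_univ, hasFDerivWithinAt_euclidean]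
    intro k
    rw [hasFDerivWithinAt_univ]
    convert! (hLg k).hasFDerivAt using 1
    ext v
    simp [EuclideanSpace.inner_single_left]
  have hΛd : DifferentiableWithinAt ℝ (fun r => Λ (θ r)) s t := by
    rw [differentiableWithinAt_euclidean]
    exact fun k => hLd k
  -- `Λ` has derivative the identity at `θ t`, so by continuity of `θ` the increments of `θ` and of
  -- `Λ ∘ θ` are equivalent. The latter are O(r - t), hence the two differ by o(r - t).
  have h1 : (fun r => (Λ (θ r) - Λ (θ t)) - (θ r - θ t)) =o[𝓝[s] t] fun r => θ r - θ t := by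
    simpa [Function.comp_def] using hΛ.isLittleO.comp_tendsto hθ
  have h2 : (fun r => θ r - θ t) =O[𝓝[s] t] fun r => Λ (θ r) - Λ (θ t) :=
    Asymptotics.IsEquivalent.isBigO_symm h1
  have h3 : (fun r => Λ (θ r) - Λ (θ t)) =O[𝓝[s] t] fun r => r - t :=
    hΛd.hasFDerivWithinAt.isBigO_sub
  have h4 := h1.trans_isBigO (h2.trans h3)
  refine ⟨fderivWithin ℝ (fun r => Λ (θ r)) s t, .of_isLittleO ?_⟩
  convert! (hΛd.hasFDerivWithinAt.isLittleO.sub h4) using 2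
  abel

/-! ### Densities and test functions in weighted Sobolev spaces. -/

namespace ParticleFlow

theorem integral_densityMeasure {d : ℕ} {ρ : E d → ℝ} (hm : Measurable ρ) (h0 : ∀ x, 0 ≤ ρ x)
    (f : E d → ℝ) : ∫ x, f x ∂densityMeasure ρ = ∫ x, f x * ρ x := by
  rw [densityMeasure, integral_withDensity_eq_integral_toReal_smul hm.ennreal_ofReal
    (ae_of_all _ fun x => ENNReal.ofReal_lt_top)]
  refine integral_congr_ae (ae_of_all _ fun x => ?_)
  simp [ENNReal.toReal_ofReal (h0 x), mul_comm]

theorem inner_gradient_left {V : Type*} [NormedAddCommGroup V] [InnerProductSpace ℝ V]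
    [CompleteSpace V] (f : V → ℝ) (x v : V) : inner ℝ (gradient f x) v = fderiv ℝ f x v := by
  simp [gradient]

theorem continuous_gradient {V : Type*} [NormedAddCommGroup V] [InnerProductSpace ℝ V]
    [CompleteSpace V] {f : V → ℝ} (hf : ContDiff ℝ 1 f) : Continuous (gradient f) :=
  (InnerProductSpace.toDual ℝ V).symm.continuous.comp (hf.continuous_fderiv one_ne_zero)

theorem hasCompactSupport_gradient {V : Type*} [NormedAddCommGroup V] [InnerProductSpace ℝ V]
    [CompleteSpace V] {f : V → ℝ} (hf : HasCompactSupport f) : HasCompactSupport (gradient f) :=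
  (hf.fderiv (𝕜 := ℝ)).comp_left (map_zero _)

/-- Test functions lie in every weighted Sobolev space. -/
theorem memH1_of_contDiff {d : ℕ} {ρ : E d → ℝ} [IsFiniteMeasure (densityMeasure ρ)]
    {η : E d → ℝ} (hη : ContDiff ℝ ∞ η) (hs : HasCompactSupport η) :
    MemH1 ρ η (gradient η) where
  memLp := hη.continuous.memLp_of_hasCompactSupport hs
  memLp_grad := (continuous_gradient (hη.of_le (by simp))).memLp_of_hasCompactSupport
    (hasCompactSupport_gradient hs)
  hasWeakGradient := by
    have hc := continuous_gradient (hη.of_le (m := 1) (by simp))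
    refine ⟨hη.continuous.locallyIntegrable, hc.locallyIntegrable, fun ζ hζ hζs => ?_⟩
    have hcζ := continuous_gradient (hζ.of_le (m := 1) (by simp))
    have i1 : Integrable (fun x => η x • gradient ζ x) volume :=
      (hη.continuous.smul hcζ).integrable_of_hasCompactSupport hs.smul_right
    have i2 : Integrable (fun x => ζ x • gradient η x) volume :=
      (hζ.continuous.smul hc).integrable_of_hasCompactSupport hζs.smul_right
    -- Pairing with `v` reduces the claim to scalar integration by parts in the direction `v`.
    refine ext_inner_right ℝ fun v => ?_
    rw [inner_neg_left, real_inner_comm, real_inner_comm v (∫ x, ζ x • gradient η x),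
      ← integral_inner i1, ← integral_inner i2]
    have j1 := i1.const_inner (𝕜 := ℝ) v
    have j2 := i2.const_inner (𝕜 := ℝ) v
    simp only [real_inner_comm _ v, inner_smul_left, inner_gradient_left, RCLike.conj_to_real]
      at j1 j2 ⊢
    rw [integral_mul_fderiv_eq_neg_fderiv_mul_of_integrable]
    · simp [mul_comm]
    · simpa [mul_comm] using j2
    · exact j1
    · exact (hη.continuous.mul hζ.continuous).integrable_of_hasCompactSupport hs.mul_right
    · exact fun x _ => (hη.differentiable (by simp)) x
    · exact fun x _ => (hζ.differentiable (by simp)) x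

/-! ### Weak evolution equation of the particle density. -/

section Filter

variable {d : ℕ} {Ω : Type*} [MeasurableSpace Ω] {P : Measure Ω}
  {β : ℝ} {h p₀ : E d → ℝ} {X : ℝ → Ω → E d} {p : ℝ → E d → ℝ} {φ : ℝ → E d → ℝ}
  {gradφ : ℝ → E d → E d}

theorem IsParticleFilter.ae_integrableOn_velocity [IsProbabilityMeasure P]
    (hX : IsParticleFilter P β h p₀ X p φ gradφ) :
    ∀ᵐ w ∂P, ∀ T, IntegrableOn (fun s => gradφ s (X s w)) (Icc 0 T) := by
  have : ∀ᵐ w ∂P, ∀ n : ℕ, IntegrableOn (fun s => gradφ s (X s w)) (Icc 0 n) := by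
    rw [ae_all_iff]
    exact fun n => (hX.integrable_velocity n n.cast_nonneg).prod_left_ae
  filter_upwards [this] with w hw T
  obtain ⟨n, hn⟩ := exists_nat_ge T
  exact (hw n).mono_set (Icc_subset_Icc_right hn)

theorem IsParticleFilter.ae_continuousOn [IsProbabilityMeasure P]
    (hX : IsParticleFilter P β h p₀ X p φ gradφ) :
    ∀ᵐ w ∂P, ContinuousOn (fun t => X t w) (Ici 0) := by
  filter_upwards [hX.ae_integrableOn_velocity, hX.ode] with w hw hode
  have hc : ContinuousOn (fun t => ∫ s in (0 : ℝ)..t, -β • gradφ s (X s w)) (Ici 0) := by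
    intro t ht
    -- The horizon `t + 1` makes `[0, t + 1]` a neighbourhood of `t` within `[0, ∞)`.
    have h1 : (0 : ℝ) ≤ t + 1 := by have := mem_Ici.1 ht; linarith
    have := intervalIntegral.continuousOn_primitive_interval (μ := volume)
      (f := fun s => -β • gradφ s (X s w)) (a := 0) (b := t + 1)
      (by rw [uIcc_of_le h1]; exact (hw (t + 1)).smul (-β))
    rw [uIcc_of_le h1] at this
    refine (this t ⟨ht, by linarith⟩).mono_of_mem_nhdsWithin ?_
    filter_upwards [self_mem_nhdsWithin, mem_nhdsWithin_of_mem_nhds (Iic_mem_nhds (lt_add_one t))]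
      with r hr hr'
    exact ⟨hr, hr'⟩
  exact (continuousOn_const.add hc).congr fun t ht => hode t ht

theorem IsParticleFilter.isProbabilityMeasure [IsProbabilityMeasure P]
    (hX : IsParticleFilter P β h p₀ X p φ gradφ)
    {t : ℝ} (ht : 0 ≤ t) : IsProbabilityMeasure (densityMeasure (p t)) := by
  rw [← hX.law t ht]
  exact Measure.isProbabilityMeasure_map (hX.measurable t ht).aemeasurable

theorem IsParticleFilter.integral_comp (hX : IsParticleFilter P β h p₀ X p φ gradφ)
    {t : ℝ} (ht : 0 ≤ t) {f : E d → ℝ} (hf : AEStronglyMeasurable f (densityMeasure (p t))) :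
    ∫ w, f (X t w) ∂P = ∫ x, f x * p t x := by
  rw [← integral_densityMeasure (hX.density_measurable t ht) (hX.density_nonneg t ht),
    ← hX.law t ht, integral_map (hX.measurable t ht).aemeasurable (hX.law t ht ▸ hf)]

/-- The weak form of the evolution equation of the density of a particle. -/
theorem IsParticleFilter.integral_mul_density_sub [IsProbabilityMeasure P]
    (hX : IsParticleFilter P β h p₀ X p φ gradφ)
    {η : E d → ℝ} (hη : ContDiff ℝ ∞ η) (hs : HasCompactSupport η) {T : ℝ} (hT : 0 ≤ T) :
    (∫ x, η x * p T x) - ∫ x, η x * p 0 x =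
      ∫ s in (0 : ℝ)..T, -β * ∫ x, (h x - ∫ y, h y * p s y) * η x * p s x := by
  have hη1 : ContDiff ℝ 1 η := hη.of_le (by simp)
  have hgc := continuous_gradient hη1
  obtain ⟨K, hK⟩ := hη1.lipschitzWith_of_hasCompactSupport hs one_ne_zero
  have hpath : ∀ᵐ w ∂P, η (X T w) - η (X 0 w) =
      ∫ s in Icc 0 T, inner ℝ (gradient η (X s w)) (-β • gradφ s (X s w)) := by
    filter_upwards [hX.ae_integrableOn_velocity, hX.ode] with w hw hode
    have hii : IntervalIntegrable (fun s => -β • gradφ s (X s w)) volume 0 T :=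
      (intervalIntegrable_iff_integrableOn_Icc_of_le hT).2 ((hw T).smul (-β))
    rw [Differentiable.comp_primitive_sub_eq_integral (x := fun s => X s w)
      (hη1.differentiable one_ne_zero) hK hT hii
      fun t ht => hode t ht.1, intervalIntegral.integral_of_le hT, integral_Icc_eq_integral_Ioc]
    simp only [inner_gradient_left]
  have hm := aestronglyMeasurable_of_ae_continuousOn_Ici hX.measurable hX.ae_continuousOn T
  have hi : Integrable (fun z : ℝ × Ω => inner ℝ (gradient η (X z.1 z.2))
      (-β • gradφ z.1 (X z.1 z.2))) ((volume.restrict (Icc 0 T)).prod P) := by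
    obtain ⟨C, hC⟩ := hgc.bounded_above_of_compact_support (hasCompactSupport_gradient hs)
    have hv := (hX.integrable_velocity T hT).smul (-β)
    refine (hv.norm.const_mul C).mono'
      ((hgc.comp_aestronglyMeasurable hm).inner hv.aestronglyMeasurable)
      (ae_of_all _ fun z => ?_)
    exact (norm_inner_le_norm _ _).trans (mul_le_mul_of_nonneg_right (hC _) (norm_nonneg _))
  have hηi : ∀ t, 0 ≤ t → Integrable (fun w => η (X t w)) P := by
    intro t ht
    obtain ⟨C, hC⟩ := hη.continuous.bounded_above_of_compact_support hs
    exact Integrable.of_bound (hη.continuous.comp_aestronglyMeasurable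
      (hX.measurable t ht).aestronglyMeasurable) C (ae_of_all _ fun w => hC _)
  have hηm : ∀ t, AEStronglyMeasurable η (densityMeasure (p t)) :=
    fun t => hη.continuous.aestronglyMeasurable
  rw [← hX.integral_comp hT (hηm T), ← hX.integral_comp le_rfl (hηm 0),
    ← integral_sub (hηi T hT) (hηi 0 le_rfl), integral_congr_ae hpath,
    ← integral_integral_swap hi, intervalIntegral.integral_of_le hT,
    ← integral_Icc_eq_integral_Ioc]
  refine setIntegral_congr_fun measurableSet_Icc fun s hsT => ?_
  have hs0 : 0 ≤ s := hsT.1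
  have := hX.isProbabilityMeasure hs0
  have hpo := hX.poisson s hs0
  -- At fixed `s`, testing the Poisson equation with `η` eliminates the unknown `φ`.
  rw [← hpo.weak_eq η (gradient η) (memH1_of_contDiff hη hs), ← integral_const_mul,
    hX.integral_comp hs0 (f := fun x => inner ℝ (gradient η x) (-β • gradφ s x))
      (hgc.aestronglyMeasurable.inner (hpo.memH1.memLp_grad.aestronglyMeasurable.const_smul (-β)))]
  refine integral_congr_ae (ae_of_all _ fun x => ?_)
  simp only [inner_smul_right, real_inner_comm (gradient η x)]
  ring

end Filter

end ParticleFlow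

/-! ### Differentiation under the integral in the parametric family. -/

namespace ParticleFlow

section Family

variable {d M : ℕ} {h : E d → ℝ} {Θ : Set (E M)} {ϱ : E d → E M → ℝ}

/-- Directional derivatives in a parameter depend measurably on the point. -/
theorem measurable_gradient_param {α : Type*} [MeasurableSpace α] {f : α → E M → ℝ} {ϑ : E M}
    (hm : ∀ᶠ ϑ' in 𝓝 ϑ, Measurable fun x => f x ϑ')
    (hd : ∀ x, DifferentiableAt ℝ (f x) ϑ) : Measurable fun x => gradient (f x) ϑ := by
  have hcoord : ∀ k : Fin M, Measurable fun x => gradient (f x) ϑ k := by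
    intro k
    let e : E M := EuclideanSpace.single k 1
    have hlim : Tendsto (fun n : ℕ => ϑ + (1 / ((n : ℝ) + 1)) • e) atTop (𝓝 ϑ) := by
      have := (tendsto_one_div_add_atTop_nhds_zero_nat (𝕜 := ℝ)).smul_const e
      simpa using this.const_add ϑ
    -- Difference quotients are measurable only near `ϑ`, hence the shift by `N` in the sequence.
    obtain ⟨N, hN⟩ := eventually_atTop.1 (hlim.eventually hm)
    refine measurable_of_tendsto_metrizable
      (f := fun (n : ℕ) x => ((n + N : ℕ) + 1 : ℝ) •
        (f x (ϑ + (1 / (((n + N : ℕ) : ℝ) + 1)) • e) - f x ϑ))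
      (fun n => ((hN (n + N) (Nat.le_add_left _ _)).sub hm.self_of_nhds).const_smul
        (((n + N : ℕ) : ℝ) + 1)) ?_
    rw [tendsto_pi_nhds]
    intro x
    have hg : gradient (f x) ϑ k = fderiv ℝ (f x) ϑ e := by
      rw [← inner_gradient_left, EuclideanSpace.inner_single_right]
      simp
    rw [hg]
    have h1 := (hd x).hasFDerivAt.lim (v := e) (l := atTop) (c := fun n : ℕ => ((n : ℝ) + 1))
      (by
        simp only [Real.norm_eq_abs]
        exact tendsto_abs_atTop_atTop.comp
          (tendsto_atTop_add_const_right _ _ tendsto_natCast_atTop_atTop))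
    have h2 := h1.comp (tendsto_add_atTop_nat N)
    simpa [Function.comp_def] using h2
  exact (WithLp.measurable_toLp 2 (Fin M → ℝ)).comp (measurable_pi_lambda _ hcoord)

theorem IsRegularFamily.gradient_eq_smul_score (hϱ : IsRegularFamily h Θ ϱ) {ϑ : E M}
    (hϑ : ϑ ∈ Θ) (x : E d) : gradient (ϱ x) ϑ = ϱ x ϑ • score ϱ x ϑ := by
  have hpos := (hϱ.pos ϑ hϑ x).ne'
  have := ((hϱ.differentiableAt ϑ hϑ x).hasGradientAt.hasFDerivAt.log hpos)
  have h2 : HasGradientAt (fun ϑ' => Real.log (ϱ x ϑ')) ((ϱ x ϑ)⁻¹ • gradient (ϱ x) ϑ) ϑ := by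
    rw [hasGradientAt_iff_hasFDerivAt]
    simpa using this
  rw [score, h2.gradient, smul_smul, mul_inv_cancel₀ hpos, one_smul]

theorem IsRegularFamily.integrable (hϱ : IsRegularFamily h Θ ϱ) {ϑ : E M} (hϑ : ϑ ∈ Θ) :
    Integrable fun x => ϱ x ϑ := by
  -- A non-integrable function has integral 0 by convention, not 1.
  by_contra hcon
  have := hϱ.integral_eq_one ϑ hϑ
  rw [integral_undef hcon] at this
  exact zero_ne_one this

theorem IsRegularFamily.measurable_gradient (hϱ : IsRegularFamily h Θ ϱ) (hΘ : IsOpen Θ)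
    {ϑ : E M} (hϑ : ϑ ∈ Θ) : Measurable fun x => gradient (ϱ x) ϑ :=
  measurable_gradient_param
    ((hΘ.eventually_mem hϑ).mono fun ϑ' h' => hϱ.measurable ϑ' h') (hϱ.differentiableAt ϑ hϑ)

/-- The growth bound C(1 + |h|) is the one matched to the domination hypothesis; it covers the
weights 1, `h`, `η` and `h η`. -/
theorem IsRegularFamily.integrable_mul (hϱ : IsRegularFamily h Θ ϱ)
    {w : E d → ℝ} (hw : AEStronglyMeasurable w) {C : ℝ} (hC : ∀ x, |w x| ≤ C * (1 + |h x|))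
    {ϑ : E M} (hϑ : ϑ ∈ Θ) : Integrable fun x => w x * ϱ x ϑ := by
  refine (((hϱ.integrable hϑ).add (hϱ.cost_integrable ϑ hϑ).norm).const_mul C).mono'
    (hw.mul (hϱ.measurable ϑ hϑ).aestronglyMeasurable) (ae_of_all _ fun x => ?_)
  have hp := hϱ.pos ϑ hϑ x
  simp only [Pi.add_apply, norm_mul, Real.norm_eq_abs, abs_of_pos hp]
  nlinarith [mul_le_mul_of_nonneg_right (hC x) hp.le]

/-- Differentiation under the integral sign in a regular family. -/
theorem IsRegularFamily.hasGradientAt_integral (hϱ : IsRegularFamily h Θ ϱ) (hΘ : IsOpen Θ)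
    {w : E d → ℝ} (hw : AEStronglyMeasurable w) {C : ℝ} (hC : ∀ x, |w x| ≤ C * (1 + |h x|))
    {ϑ : E M} (hϑ : ϑ ∈ Θ) :
    Integrable (fun x => w x • gradient (ϱ x) ϑ) ∧
      HasGradientAt (fun ϑ' => ∫ x, w x * ϱ x ϑ') (∫ x, w x • gradient (ϱ x) ϑ) ϑ := by
  obtain ⟨U, hU, b, hb, hbd⟩ := hϱ.dominated ϑ hϑ
  have hgm : AEStronglyMeasurable (fun x => w x • gradient (ϱ x) ϑ) :=
    hw.smul (hϱ.measurable_gradient hΘ hϑ).aestronglyMeasurable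
  have hbound : ∀ᵐ x, ∀ ϑ' ∈ U ∩ Θ, ‖w x • gradient (ϱ x) ϑ'‖ ≤ C * b x := by
    filter_upwards [hbd] with x hx ϑ' hϑ'
    have hC0 : 0 ≤ C := by
      have h1 : 0 < 1 + |h x| := by positivity
      have := (abs_nonneg _).trans (hC x)
      exact nonneg_of_mul_nonneg_left this h1
    rw [norm_smul, Real.norm_eq_abs]
    calc |w x| * ‖gradient (ϱ x) ϑ'‖ ≤ C * (1 + |h x|) * ‖gradient (ϱ x) ϑ'‖ :=
          mul_le_mul_of_nonneg_right (hC x) (norm_nonneg _)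
      _ = C * ((1 + |h x|) * ‖gradient (ϱ x) ϑ'‖) := by ring
      _ ≤ C * b x := mul_le_mul_of_nonneg_left (hx ϑ' hϑ'.1) hC0
  have hUΘ : U ∩ Θ ∈ 𝓝 ϑ := inter_mem hU (hΘ.mem_nhds hϑ)
  have hint : Integrable (fun x => w x • gradient (ϱ x) ϑ) :=
    (hb.const_mul C).mono' hgm (hbound.mono fun x hx => hx ϑ (mem_of_mem_nhds hUΘ))
  refine ⟨hint, ?_⟩
  have key := hasFDerivAt_integral_of_dominated_of_fderiv_le (μ := volume) (𝕜 := ℝ)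
    (F := fun ϑ' x => w x * ϱ x ϑ')
    (F' := fun ϑ' x => InnerProductSpace.toDual ℝ (E M) (w x • gradient (ϱ x) ϑ'))
    (bound := fun x => C * b x) hUΘ
    (by
      filter_upwards [hΘ.mem_nhds hϑ] with ϑ' h'
      exact hw.mul (hϱ.measurable ϑ' h').aestronglyMeasurable)
    (hϱ.integrable_mul hw hC hϑ)
    ((InnerProductSpace.toDual ℝ (E M)).continuous.comp_aestronglyMeasurable hgm)
    (by simpa only [LinearIsometryEquiv.norm_map] using hbound)
    (hb.const_mul C)
    (ae_of_all _ fun x ϑ' h' => by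
      simpa using (hϱ.differentiableAt ϑ' h'.2 x).hasGradientAt.hasFDerivAt.const_mul (w x))
  rw [hasGradientAt_iff_hasFDerivAt]
  convert! key using 1
  exact ((InnerProductSpace.toDual ℝ (E M)).toContinuousLinearEquiv.integral_comp_comm
    (fun x => w x • gradient (ϱ x) ϑ)).symm

theorem IsRegularFamily.continuousOn_integral (hϱ : IsRegularFamily h Θ ϱ) (hΘ : IsOpen Θ)
    {w : E d → ℝ} (hw : AEStronglyMeasurable w) {C : ℝ} (hC : ∀ x, |w x| ≤ C * (1 + |h x|)) :
    ContinuousOn (fun ϑ => ∫ x, w x * ϱ x ϑ) Θ := fun _ hϑ =>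
  (hϱ.hasGradientAt_integral hΘ hw hC hϑ).2.hasFDerivAt.continuousAt.continuousWithinAt

end Family

end ParticleFlow

/-! ### Score, Fisher information and the gradients of moments. -/

namespace ParticleFlow

theorem exists_abs_le_mul_one_add_abs {α : Type*} [TopologicalSpace α] (h : α → ℝ) {η : α → ℝ}
    (hη : Continuous η) (hs : HasCompactSupport η) :
    ∃ C, (∀ x, |η x| ≤ C * (1 + |h x|)) ∧ ∀ x, |h x * η x| ≤ C * (1 + |h x|) := by
  obtain ⟨C, hC⟩ := hη.bounded_above_of_compact_support hs
  simp only [Real.norm_eq_abs] at hC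
  refine ⟨C, fun x => ?_, fun x => ?_⟩
  · nlinarith [hC x, mul_nonneg ((abs_nonneg _).trans (hC x)) (abs_nonneg (h x))]
  · rw [abs_mul]
    nlinarith [(abs_nonneg _).trans (hC x), mul_le_mul_of_nonneg_left (hC x) (abs_nonneg (h x))]

section Family

variable {d M : ℕ} {h : E d → ℝ} {Θ : Set (E M)} {ϱ : E d → E M → ℝ} {ϑ : E M}

theorem IsRegularFamily.integrable_gradient (hϱ : IsRegularFamily h Θ ϱ) (hΘ : IsOpen Θ)
    (hϑ : ϑ ∈ Θ) : Integrable fun x => gradient (ϱ x) ϑ := by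
  simpa using (hϱ.hasGradientAt_integral hΘ (w := fun _ => 1) (C := 1)
    aestronglyMeasurable_const (fun x => by simp) hϑ).1

/-- The total mass is constantly 1 near `ϑ`; equivalently, the score has mean zero. -/
theorem IsRegularFamily.integral_gradient (hϱ : IsRegularFamily h Θ ϱ) (hΘ : IsOpen Θ)
    (hϑ : ϑ ∈ Θ) : ∫ x, gradient (ϱ x) ϑ = 0 := by
  have h1 : HasGradientAt (fun ϑ' => ∫ x, ϱ x ϑ') (∫ x, gradient (ϱ x) ϑ) ϑ := by
    simpa using (hϱ.hasGradientAt_integral hΘ (w := fun _ => 1) (C := 1)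
      aestronglyMeasurable_const (fun x => by simp) hϑ).2
  have h2 : HasGradientAt (fun ϑ' => ∫ x, ϱ x ϑ') 0 ϑ := by
    have he : (fun ϑ' => ∫ x, ϱ x ϑ') =ᶠ[𝓝 ϑ] fun _ => (1 : ℝ) := by
      filter_upwards [hΘ.mem_nhds hϑ] with ϑ' h'
      exact hϱ.integral_eq_one ϑ' h'
    exact (hasGradientAt_const ϑ (1 : ℝ)).congr_of_eventuallyEq he
  exact h1.unique h2

theorem integral_apply {α : Type*} [MeasurableSpace α] {μ : Measure α} {f : α → E M}
    (hf : Integrable f μ) (k : Fin M) : (∫ x, f x ∂μ) k = ∫ x, f x k ∂μ :=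
  ((EuclideanSpace.proj (𝕜 := ℝ) k).integral_comp_comm hf).symm

theorem integrable_apply {α : Type*} [MeasurableSpace α] {μ : Measure α} {f : α → E M}
    (hf : Integrable f μ) (k : Fin M) : Integrable (fun x => f x k) μ :=
  (EuclideanSpace.proj (𝕜 := ℝ) k).integrable_comp hf

theorem IsRegularFamily.hasGradientAt_expectedCost (hϱ : IsRegularFamily h Θ ϱ) (hΘ : IsOpen Θ)
    (hh : Continuous h) (hϑ : ϑ ∈ Θ) :
    Integrable (fun x => h x • gradient (ϱ x) ϑ) ∧
      HasGradientAt (expectedCost h ϱ) (costGradient h ϱ ϑ) ϑ := by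
  obtain ⟨hi, hg⟩ := hϱ.hasGradientAt_integral hΘ (w := h) (C := 1)
    hh.aestronglyMeasurable (fun x => by linarith [abs_nonneg (h x)]) hϑ
  refine ⟨hi, ?_⟩
  convert! hg using 1
  ext k
  rw [integral_apply hi]
  refine integral_congr_ae (ae_of_all _ fun x => ?_)
  simp only [hϱ.gradient_eq_smul_score hϑ, PiLp.smul_apply, smul_eq_mul]
  ring

theorem IsRegularFamily.integrable_score_mul_score (hϱ : IsRegularFamily h Θ ϱ) (hΘ : IsOpen Θ)
    (hϑ : ϑ ∈ Θ) (k l : Fin M) :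
    Integrable fun x => score ϱ x ϑ k * score ϱ x ϑ l * ϱ x ϑ := by
  have hsm : ∀ k, Measurable fun x => score ϱ x ϑ k := by
    intro k
    have h1 : (fun x => score ϱ x ϑ k) = fun x => (ϱ x ϑ)⁻¹ * gradient (ϱ x) ϑ k := by
      ext x
      rw [hϱ.gradient_eq_smul_score hϑ, PiLp.smul_apply, smul_eq_mul,
        inv_mul_cancel_left₀ (hϱ.pos ϑ hϑ x).ne']
    rw [h1]
    exact (hϱ.measurable ϑ hϑ).inv.mul
      ((EuclideanSpace.proj (𝕜 := ℝ) k).continuous.measurable.comp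
        (hϱ.measurable_gradient hΘ hϑ))
  refine ((hϱ.score_sq_integrable ϑ hϑ k).add (hϱ.score_sq_integrable ϑ hϑ l)).mono'
    (((hsm k).mul (hsm l)).mul (hϱ.measurable ϑ hϑ)).aestronglyMeasurable
    (ae_of_all _ fun x => ?_)
  have hp := hϱ.pos ϑ hϑ x
  simp only [Pi.add_apply, norm_mul, Real.norm_eq_abs, abs_of_pos hp, ← add_mul]
  refine mul_le_mul_of_nonneg_right ?_ hp.le
  nlinarith [sq_nonneg (|score ϱ x ϑ k| - |score ϱ x ϑ l|), sq_abs (score ϱ x ϑ k),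
    sq_abs (score ϱ x ϑ l), sq_nonneg (score ϱ x ϑ k), sq_nonneg (score ϱ x ϑ l)]

/-- The action of the Fisher information matrix on a vector. -/
theorem IsRegularFamily.fisherInfo_mulVec (hϱ : IsRegularFamily h Θ ϱ) (hΘ : IsOpen Θ)
    (hϑ : ϑ ∈ Θ) (v : E M) (k : Fin M) :
    (fisherInfo ϱ ϑ *ᵥ v.ofLp) k =
      ∫ x, score ϱ x ϑ k * inner ℝ (gradient (ϱ x) ϑ) v := by
  simp only [Matrix.mulVec, dotProduct, fisherInfo, Matrix.of_apply]
  simp only [← integral_mul_const]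
  rw [← integral_finsetSum _ fun l _ => (hϱ.integrable_score_mul_score hΘ hϑ k l).mul_const _]
  refine integral_congr_ae (ae_of_all _ fun x => ?_)
  simp only [hϱ.gradient_eq_smul_score hϑ, inner_smul_left, PiLp.inner_apply, Finset.mul_sum]
  refine Finset.sum_congr rfl fun l _ => ?_
  simp
  ring

/-- If the Fisher information is invertible, then the moments against test functions have enough
gradients in the parameter. -/
theorem IsRegularFamily.span_integral_smul_gradient (hϱ : IsRegularFamily h Θ ϱ) (hΘ : IsOpen Θ)
    (hϑ : ϑ ∈ Θ) (hG : IsUnit (fisherInfo ϱ ϑ)) :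
    Submodule.span ℝ {a : E M | ∃ η : E d → ℝ, ContDiff ℝ ∞ η ∧ HasCompactSupport η ∧
      a = ∫ x, η x • gradient (ϱ x) ϑ} = ⊤ := by
  rw [← Submodule.orthogonal_eq_bot_iff, Submodule.eq_bot_iff]
  intro v hv
  have hgi := hϱ.integrable_gradient hΘ hϑ
  -- Fundamental lemma of the calculus of variations: `v` is orthogonal to every moment gradient.
  have h0 : ∀ᵐ x, inner ℝ (gradient (ϱ x) ϑ) v = 0 := by
    refine ae_eq_zero_of_integral_contDiff_smul_eq_zero (hgi.inner_const v).locallyIntegrable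
      fun η hη hs => ?_
    obtain ⟨C, hC⟩ := hη.continuous.bounded_above_of_compact_support hs
    have hi : Integrable fun x => η x • gradient (ϱ x) ϑ :=
      hgi.bdd_smul C hη.continuous.aestronglyMeasurable (ae_of_all _ hC)
    have := (Submodule.mem_orthogonal' _ _).1 hv _ (Submodule.subset_span ⟨η, hη, hs, rfl⟩)
    rw [← integral_inner hi] at this
    simpa [inner_smul_right, real_inner_comm] using this
  have hGv : fisherInfo ϱ ϑ *ᵥ v.ofLp = 0 := by
    ext k
    rw [hϱ.fisherInfo_mulVec hΘ hϑ, Pi.zero_apply]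
    exact integral_eq_zero_of_ae (h0.mono fun x hx => by simp [hx])
  have hv0 := Matrix.mulVec_injective_of_isUnit hG (hGv.trans (Matrix.mulVec_zero _).symm)
  ext k
  exact congrFun hv0 k

/-- The vector that represents, in the score directions, the centred function `h`. -/
theorem IsRegularFamily.eq_neg_smul_inv_fisherInfo (hϱ : IsRegularFamily h Θ ϱ) (hΘ : IsOpen Θ)
    (hh : Continuous h) (hϑ : ϑ ∈ Θ) (hG : IsUnit (fisherInfo ϱ ϑ)) {β : ℝ} {v : E M}
    (hv : ∀ η : E d → ℝ, ContDiff ℝ ∞ η → HasCompactSupport η →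
      inner ℝ (∫ x, η x • gradient (ϱ x) ϑ) v =
        -β * ∫ x, (h x - expectedCost h ϱ ϑ) * η x * ϱ x ϑ) :
    v = -β • WithLp.toLp 2 ((fisherInfo ϱ ϑ)⁻¹ *ᵥ (costGradient h ϱ ϑ).ofLp) := by
  have hgi := hϱ.integrable_gradient hΘ hϑ
  set e := expectedCost h ϱ ϑ
  have hci : Integrable fun x => β * ((h x - e) * ϱ x ϑ) := by
    refine Integrable.const_mul ?_ β
    simp only [sub_mul]
    exact (hϱ.cost_integrable ϑ hϑ).sub ((hϱ.integrable hϑ).const_mul e)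
  have h0 : ∀ᵐ x, inner ℝ (gradient (ϱ x) ϑ) v + β * ((h x - e) * ϱ x ϑ) = 0 := by
    refine ae_eq_zero_of_integral_contDiff_smul_eq_zero
      ((hgi.inner_const v).add hci).locallyIntegrable fun η hη hs => ?_
    obtain ⟨C, hC⟩ := hη.continuous.bounded_above_of_compact_support hs
    have hi : Integrable fun x => η x • gradient (ϱ x) ϑ :=
      hgi.bdd_smul C hη.continuous.aestronglyMeasurable (ae_of_all _ hC)
    have hci' : Integrable fun x => η x • (β * ((h x - e) * ϱ x ϑ)) :=
      hci.bdd_smul C hη.continuous.aestronglyMeasurable (ae_of_all _ hC)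
    have hii : Integrable fun x => η x • inner ℝ (gradient (ϱ x) ϑ) v :=
      (hgi.inner_const v).bdd_smul C hη.continuous.aestronglyMeasurable (ae_of_all _ hC)
    have h1 := hv η hη hs
    rw [real_inner_comm, ← integral_inner hi] at h1
    simp only [smul_add]
    rw [integral_add hii hci']
    have h2 : ∫ x, η x • inner ℝ (gradient (ϱ x) ϑ) v =
        ∫ x, inner ℝ v (η x • gradient (ϱ x) ϑ) :=
      integral_congr_ae (ae_of_all _ fun x => by
        simp only [inner_smul_right, smul_eq_mul, real_inner_comm v])
    have h3 : ∫ x, η x • (β * ((h x - e) * ϱ x ϑ)) = β * ∫ x, (h x - e) * η x * ϱ x ϑ := by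
      rw [← integral_const_mul]
      exact integral_congr_ae (ae_of_all _ fun x => by simp only [smul_eq_mul]; ring)
    rw [h2, h3, h1]
    ring
  -- Integrate the pointwise identity `h0` against the score; the constant `e` drops out because the
  -- score has mean zero.
  have hGv : fisherInfo ϱ ϑ *ᵥ v.ofLp = -β • (costGradient h ϱ ϑ).ofLp := by
    ext k
    have hhi := (hϱ.hasGradientAt_expectedCost hΘ hh hϑ).1
    have hzero : ∫ x, gradient (ϱ x) ϑ k = 0 := by
      rw [← integral_apply hgi, hϱ.integral_gradient hΘ hϑ]
      rfl
    rw [hϱ.fisherInfo_mulVec hΘ hϑ]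
    have h1 : ∫ x, score ϱ x ϑ k * inner ℝ (gradient (ϱ x) ϑ) v =
        ∫ x, -β * ((h x • gradient (ϱ x) ϑ) k - e * gradient (ϱ x) ϑ k) := by
      refine integral_congr_ae (h0.mono fun x hx => ?_)
      simp only
      rw [eq_neg_of_add_eq_zero_left hx]
      simp only [hϱ.gradient_eq_smul_score hϑ, PiLp.smul_apply, smul_eq_mul]
      ring
    rw [h1, integral_const_mul, integral_sub (integrable_apply hhi k)
      ((integrable_apply hgi k).const_mul e), integral_const_mul, hzero]
    simp only [mul_zero, sub_zero, Pi.smul_apply, smul_eq_mul, costGradient]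
    congr 1
    refine integral_congr_ae (ae_of_all _ fun x => ?_)
    simp only [hϱ.gradient_eq_smul_score hϑ, PiLp.smul_apply, smul_eq_mul]
    ring
  have hdet := (Matrix.isUnit_iff_isUnit_det _).1 hG
  have h2 := congrArg (fun u => (fisherInfo ϱ ϑ)⁻¹ *ᵥ u) hGv
  simp only [Matrix.mulVec_mulVec, Matrix.nonsing_inv_mul _ hdet, Matrix.one_mulVec,
    Matrix.mulVec_smul] at h2
  ext k
  simpa using congrFun h2 k

end Family

end ParticleFlow

/-! ### The parameter flow. -/

theorem proposition2 {d M : ℕ} {Ω : Type*} [MeasurableSpace Ω]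
    (P : Measure Ω) [IsProbabilityMeasure P]
    (β : ℝ) (hβ : 0 < β)
    (h : ParticleFlow.E d → ℝ) (hh : ContDiff ℝ 2 h)
    -- the particle filter
    (p₀ : ParticleFlow.E d → ℝ) (X : ℝ → Ω → ParticleFlow.E d)
    (p : ℝ → ParticleFlow.E d → ℝ) (φ : ℝ → ParticleFlow.E d → ℝ)
    (gradφ : ℝ → ParticleFlow.E d → ParticleFlow.E d)
    (hX : ParticleFlow.IsParticleFilter P β h p₀ X p φ gradφ)
    -- the parametric family, with invertible Fisher information
    (Θ : Set (ParticleFlow.E M)) (hΘ : IsOpen Θ)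
    (ϱ : ParticleFlow.E d → ParticleFlow.E M → ℝ)
    (hϱ : ParticleFlow.IsRegularFamily h Θ ϱ)
    (hG : ∀ ϑ ∈ Θ, IsUnit (ParticleFlow.fisherInfo ϱ ϑ))
    -- the density of the particle has the parametric form
    (θ : ℝ → ParticleFlow.E M) (hθ : ContinuousOn θ (Ici 0)) (hθΘ : ∀ t, 0 ≤ t → θ t ∈ Θ)
    (hp : ∀ t, 0 ≤ t → ∀ᵐ x, p t x = ϱ x (θ t)) :
    (∀ ϑ ∈ Θ, HasGradientAt (ParticleFlow.expectedCost h ϱ)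
      (ParticleFlow.costGradient h ϱ ϑ) ϑ) ∧
    ∀ t, 0 ≤ t → HasDerivWithinAt θ
      (-β • WithLp.toLp 2 ((ParticleFlow.fisherInfo ϱ (θ t))⁻¹ *ᵥ
        (gradient (ParticleFlow.expectedCost h ϱ) (θ t)).ofLp)) (Ici 0) t := by
  have he : ∀ ϑ ∈ Θ, HasGradientAt (ParticleFlow.expectedCost h ϱ)
      (ParticleFlow.costGradient h ϱ ϑ) ϑ :=
    fun ϑ hϑ => (hϱ.hasGradientAt_expectedCost hΘ hh.continuous hϑ).2
  refine ⟨he, fun t ht => ?_⟩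
  have hmaps : MapsTo θ (Ici 0) Θ := fun s hs => hθΘ s hs
  have hmoment : ∀ η : ParticleFlow.E d → ℝ, ContDiff ℝ ∞ η → HasCompactSupport η →
      HasDerivWithinAt (fun s => ∫ x, η x * ϱ x (θ s))
        (-β * ∫ x, (h x - ParticleFlow.expectedCost h ϱ (θ t)) * η x * ϱ x (θ t)) (Ici 0) t := by
    intro η hη hs
    obtain ⟨C, hηb, hhηb⟩ :=
      ParticleFlow.exists_abs_le_mul_one_add_abs h hη.continuous hs
    have hηm : AEStronglyMeasurable η volume := hη.continuous.aestronglyMeasurable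
    have hhηm : AEStronglyMeasurable (fun x => h x * η x) volume :=
      (hh.continuous.mul hη.continuous).aestronglyMeasurable
    let F : ℝ → ℝ := fun s =>
      -β * ∫ x, (h x - ParticleFlow.expectedCost h ϱ (θ s)) * η x * ϱ x (θ s)
    -- `F` is a polynomial in the moments of `h η`, `h` and `η`, each continuous in the parameter.
    have hF : ContinuousOn F (Ici 0) := by
      have h1 := (hϱ.continuousOn_integral hΘ hhηm hhηb).comp hθ hmaps
      have h2 := (hϱ.continuousOn_integral hΘ hηm hηb).comp hθ hmaps
      have h3 : ContinuousOn (ParticleFlow.expectedCost h ϱ) Θ :=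
        fun ϑ hϑ => (he ϑ hϑ).hasFDerivAt.continuousAt.continuousWithinAt
      have h4 := continuousOn_const (c := -β) |>.mul (h1.sub ((h3.comp hθ hmaps).mul h2))
      refine h4.congr fun s hs0 => ?_
      simp only [F, Function.comp_apply, Pi.mul_apply, Pi.sub_apply]
      rw [← integral_const_mul (ParticleFlow.expectedCost h ϱ (θ s)),
        ← integral_sub (hϱ.integrable_mul hhηm hhηb (hθΘ s hs0))
        ((hϱ.integrable_mul hηm hηb (hθΘ s hs0)).const_mul _)]
      congr 1
      refine integral_congr_ae (ae_of_all _ fun x => ?_)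
      simp only
      ring
    have hint : ∀ s ∈ Ici (0 : ℝ), ∫ x, η x * ϱ x (θ s) =
        (∫ x, η x * ϱ x (θ 0)) + ∫ r in (0 : ℝ)..s, F r := by
      intro s hs0
      have h1 := hX.integral_mul_density_sub hη hs hs0
      have hcongr : ∀ r, 0 ≤ r → ∀ f : ParticleFlow.E d → ℝ,
          ∫ x, f x * p r x = ∫ x, f x * ϱ x (θ r) := fun r hr f =>
        integral_congr_ae ((hp r hr).mono fun x hx => by simp only [hx])
      rw [hcongr s hs0, hcongr 0 le_rfl, sub_eq_iff_eq_add'] at h1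
      rw [h1]
      congr 1
      refine intervalIntegral.integral_congr fun r hr => ?_
      rw [uIcc_of_le hs0] at hr
      simp only [F, hcongr r hr.1, ParticleFlow.expectedCost]
    -- Clamping time at 0 extends `F` continuously to the line, so the two-sided fundamental theorem
    -- of calculus also serves at `t = 0`.
    have hG0 : Continuous fun s => F (max s 0) :=
      hF.comp_continuous (by fun_prop) fun s => mem_Ici.2 (le_max_right _ _)
    have hderiv : HasDerivWithinAt
        (fun s => (∫ x, η x * ϱ x (θ 0)) + ∫ r in (0 : ℝ)..s, F (max r 0)) (F t) (Ici 0) t := by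
      have := (hG0.integral_hasStrictDerivAt 0 t).hasDerivAt.hasDerivWithinAt (s := Ici 0)
      rw [max_eq_left ht] at this
      exact this.const_add _
    refine hderiv.congr_of_mem (fun s hs0 => ?_) ht
    rw [hint s hs0]
    congr 1
    refine intervalIntegral.integral_congr fun r hr => ?_
    rw [uIcc_of_le hs0] at hr
    simp only [max_eq_left hr.1]
  have hgrad : ∀ η : ParticleFlow.E d → ℝ, ContDiff ℝ ∞ η → HasCompactSupport η →
      HasGradientAt (fun ϑ => ∫ x, η x * ϱ x ϑ) (∫ x, η x • gradient (ϱ x) (θ t)) (θ t) := by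
    intro η hη hs
    obtain ⟨C, hηb, -⟩ := ParticleFlow.exists_abs_le_mul_one_add_abs h hη.continuous hs
    exact (hϱ.hasGradientAt_integral hΘ hη.continuous.aestronglyMeasurable hηb (hθΘ t ht)).2
  have hdiff : DifferentiableWithinAt ℝ θ (Ici 0) t := by
    refine .of_span_gradient_eq_top (hθ t ht)
      (hϱ.span_integral_smul_gradient hΘ (hθΘ t ht) (hG _ (hθΘ t ht))) ?_
    rintro _ ⟨η, hη, hs, rfl⟩
    exact ⟨_, hgrad η hη hs, (hmoment η hη hs).differentiableWithinAt⟩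
  have hd := hdiff.hasDerivWithinAt
  rw [(he _ (hθΘ t ht)).gradient]
  convert! hd using 1
  refine (hϱ.eq_neg_smul_inv_fisherInfo hΘ hh.continuous (hθΘ t ht) (hG _ (hθΘ t ht))
    fun η hη hs => ?_).symm
  -- The moment along `θ` now has two derivatives, from the chain rule and from the evolution
  -- equation; they agree because one-sided derivatives on `[0, ∞)` are unique.
  have h1 := (hgrad η hη hs).hasFDerivAt.comp_hasDerivWithinAt t hd
  simpa using (uniqueDiffOn_Ici (0 : ℝ) t ht).eq_deriv _ h1 (hmoment η hη hs)
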